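/- Let $q$ be a formal variable; put $(q)_n=\prod_{i=1}^{n}(1-q^i)$ for $n\ge 0$ (so $(q)_0=1$) and $(q)_\infty=\prod_{i\ge1}(1-q^i)$. For integers $0<r<p$ and $0<s<p'$ with $p<p'$ coprime, let $$\chi^{p,p'}_{r,s}=\frac1{(q)_\infty}\sum_{\ell=-\infty}^{\infty}\left(q^{\ell^2pp'+\ell(p'r-ps)}-q^{(\ell p+r)(\ell p'+s)}\right)$$ be the normalised Virasoro character (Rocha-Caridi expression). **Theorem** (the case $p=2$; Gordon's formula). For every integer $e_0\ge 1$, the following identity of formal power series in $q$ holds: $$\chi^{2,2e_0+1}_{1,e_0}=\sum_{\lambda}\frac{q^{\lambda_1^2+\lambda_2^2+\cdots+\lambda_{e_0-1}^2}}{(q)_{\lambda_1-\lambda_2}(q)_{\lambda_2-\lambda_3}\cdots(q)_{\lambda_{e_0-2}-\lambda_{e_0-1}}(q)_{\lambda_{e_0-1}}},$$ where the sum is over all integer sequences $\lambda=(\lambda_1,\ldots,\lambda_{e_0-1})$ with $\lambda_1\ge\lambda_2\ge\cdots\ge\lambda_{e_0-1}\ge0$ and converges coefficientwise. (For $e_0=1$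 the only $\lambda$ is the empty sequence, and its term is $1$.) -/

import Mathlib

open scoped PowerSeries.WithPiTopology

namespace GordonFormula

open PowerSeries Finset

/-- The finite `q`-factorial `(q)_n = ∏_{i=1}^n (1 - q^i)` in `ℤ⟦q⟧`. -/
noncomputable def qFactorial (n : ℕ) : ℤ⟦X⟧ :=
  ∏ i ∈ range n, (1 - (X : ℤ⟦X⟧) ^ (i + 1))

/-- The infinite product `(q)_∞ = ∏_{i≥1} (1 - q^i)` in `ℤ⟦q⟧`. It converges coefficientwise,
by `PowerSeries.WithPiTopology.multipliable_one_sub_X_pow`. -/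
noncomputable def qFactorialInf : ℤ⟦X⟧ :=
  ∏' i : ℕ, (1 - (X : ℤ⟦X⟧) ^ (i + 1))

/-- The reciprocal `1 / f` of a formal power series `f` with constant coefficient `1`. -/
noncomputable def recip (f : ℤ⟦X⟧) : ℤ⟦X⟧ :=
  invOfUnit f 1

/-- The exponent `l² p p' + l (p' r - p s)`. -/
def expPos (p p' r s : ℕ) (l : ℤ) : ℤ :=
  l ^ 2 * p * p' + l * (p' * r - p * s)

/-- The exponent `(l p + r) (l p' + s)`. -/
def expNeg (p p' r s : ℕ) (l : ℤ) : ℤ :=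
  (l * p + r) * (l * p' + s)

/-- The summand of index `l` in the bilateral Rocha-Caridi sum. For `0 < r < p` and `0 < s < p'`
both exponents are nonnegative (see `expPos_ge` and `expNeg_ge`), so `Int.toNat` loses nothing. -/
noncomputable def rochaCaridiTerm (p p' r s : ℕ) (l : ℤ) : ℤ⟦X⟧ :=
  X ^ (expPos p p' r s l).toNat - X ^ (expNeg p p' r s l).toNat

/-- The normalised Virasoro character
`χ^{p,p'}_{r,s} = 1/(q)_∞ ∑_{l ∈ ℤ} (q^{l² p p' + l (p' r - p s)} - q^{(l p + r) (l p' + s)})`,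
meant for `0 < r < p` and `0 < s < p'`; the sum then converges (`summable_rochaCaridiTerm`). -/
noncomputable def virasoroChar (p p' r s : ℕ) : ℤ⟦X⟧ :=
  recip qFactorialInf * ∑' l : ℤ, rochaCaridiTerm p p' r s l

/-- Partitions `λ = (λ_1, …, λ_m)` with `m` parts `λ_1 ≥ λ_2 ≥ ⋯ ≥ λ_m ≥ 0`
(zero parts being allowed). The part `λ_{i+1}` is the value at the index `i : Fin m`. -/
def Parts (m : ℕ) : Type :=
  {l : Fin m → ℕ // Antitone l}

/-- `l.part i` is `λ_{i+1}`, with `λ_{i+1} = 0` beyond the last part. -/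
def Parts.part {m : ℕ} (l : Parts m) (i : ℕ) : ℕ :=
  if h : i < m then l.1 ⟨i, h⟩ else 0

/-- The summand
`q^{λ_1² + ⋯ + λ_m²} / ((q)_{λ_1 - λ_2} ⋯ (q)_{λ_{m-1} - λ_m} (q)_{λ_m})`. -/
noncomputable def gordonTerm {m : ℕ} (l : Parts m) : ℤ⟦X⟧ :=
  X ^ (∑ i ∈ range m, l.part i ^ 2) *
    recip (∏ i ∈ range m, qFactorial (l.part i - l.part (i + 1)))

/-! The facts below check that the definitions above are meaningful. -/

theorem mul_recip {f : ℤ⟦X⟧} (hf : constantCoeff f = 1) : f * recip f = 1 :=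
  mul_invOfUnit f 1 (by simpa using hf)

theorem constantCoeff_qFactorial (n : ℕ) : constantCoeff (qFactorial n) = 1 := by
  simp [qFactorial, map_prod]

theorem constantCoeff_prod_qFactorial (s : Finset ℕ) (n : ℕ → ℕ) :
    constantCoeff (∏ i ∈ s, qFactorial (n i)) = 1 := by
  simp [map_prod, constantCoeff_qFactorial]

theorem constantCoeff_qFactorialInf : constantCoeff qFactorialInf = 1 := by
  have h := (WithPiTopology.multipliable_one_sub_X_pow ℤ).map_tprod
    (constantCoeff (R := ℤ)) (WithPiTopology.continuous_constantCoeff ℤ)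
  rw [qFactorialInf, h]
  simp

theorem expPos_ge {p p' r s : ℕ} (hr : 0 < r) (hrp : r < p) (hs : 0 < s) (hsp : s < p') (l : ℤ) :
    |l| ≤ expPos p p' r s l := by
  have h1 : (p' : ℤ) * r - p * s + 1 ≤ p * p' := by
    have : (r : ℤ) ≤ p - 1 := by omega
    have : (1 : ℤ) ≤ s := by omega
    nlinarith
  have h2 : -((p' : ℤ) * r - p * s) + 1 ≤ p * p' := by
    have : (1 : ℤ) ≤ r := by omega
    have : (s : ℤ) ≤ p' - 1 := by omega
    nlinarith
  have e : expPos p p' r s l = l * (l * (p * p') + (p' * r - p * s)) := by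
    unfold expPos; ring
  rw [e]
  generalize (p' : ℤ) * r - p * s = d at *
  generalize (p : ℤ) * p' = P at *
  rcases lt_trichotomy l 0 with h | h | h
  · rw [abs_of_neg h]
    have : l * P + d ≤ -1 := by nlinarith
    nlinarith
  · simp [h]
  · rw [abs_of_pos h]
    have : 1 ≤ l * P + d := by nlinarith
    nlinarith

theorem expNeg_ge {p p' r s : ℕ} (hr : 0 < r) (hrp : r < p) (hs : 0 < s) (hsp : s < p') (l : ℤ) :
    |l| ≤ expNeg p p' r s l := by
  unfold expNeg
  rcases lt_or_ge l 0 with h | h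
  · rw [abs_of_neg h]
    have h1 : (l * p + r : ℤ) ≤ l := by nlinarith
    have h2 : (l * p' + s : ℤ) ≤ -1 := by nlinarith
    nlinarith
  · rw [abs_of_nonneg h]
    have h1 : l ≤ (l * p + r : ℤ) := by nlinarith
    have h2 : (1 : ℤ) ≤ l * p' + s := by nlinarith
    nlinarith

theorem summable_rochaCaridiTerm {p p' r s : ℕ} (hr : 0 < r) (hrp : r < p) (hs : 0 < s)
    (hsp : s < p') : Summable (rochaCaridiTerm p p' r s) := by
  rw [WithPiTopology.summable_iff_summable_coeff]
  intro d
  refine summable_of_ne_finset_zero (s := Icc (-(d : ℤ)) d) fun l hl => ?_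
  have hd : (d : ℤ) < |l| := by
    by_contra hc
    exact hl (mem_Icc.2 (abs_le.1 (not_lt.1 hc)))
  have h1 := expPos_ge hr hrp hs hsp l
  have h2 := expNeg_ge hr hrp hs hsp l
  have n1 : d ≠ (expPos p p' r s l).toNat := by omega
  have n2 : d ≠ (expNeg p p' r s l).toNat := by omega
  simp [rochaCaridiTerm, coeff_X_pow, n1, n2]

end GordonFormula

/-!
The proof is Bailey's. A Bailey pair relative to `1` is a pair of sequences `α`, `β` with
`β_n = ∑_{s ≤ n} α_s / ((q)_{n-s} (q)_{n+s})`. The unit pair has `β_n = 0` for `n > 0` and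
`α_s = (-1)^s q^{s(s-1)/2} (1 + q^s)` for `s > 0`; its defining sums telescope (`sum_unitAlpha`).
By the `q`-Vandermonde sum (`sum_antidiagonal_recipQFactorial`), replacing `α_s` by `q^{s²} α_s` and
`β_n` by `∑_{m ≤ n} q^{m²} β_m / (q)_{n-m}` gives another Bailey pair (`bailey_step`). One step
turns the unit `β` into `1 / (q)_n`, and each further step adds a part to the partition `λ`. So
`e₀` steps yield the finite identity `gordonSum_eq`, with `m = e₀ - 1`:
`∑_{λ_1 ≤ n} (term of λ) / (q)_{n-λ_1} = ∑_{s ≤ n} q^{e₀ s²} α_s / ((q)_{n-s} (q)_{n+s})`.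

As `n` grows this becomes `G / (q)_∞ = A / (q)_∞²`, where `G` is Gordon's sum and
`A = ∑_s q^{e₀ s²} α_s`. The two monomials of each `α_s` are the terms of the
Rocha-Caridi sum (`sum_range_rochaCaridiTerm`), so `A / (q)_∞` is the character. The limit is taken
in the quotient rings of `ℤ⟦q⟧` modulo `q^(d+1)`, where all sums are finite and all `(q)_n` with
`n ≥ d` coincide with `(q)_∞`.
-/

namespace GordonFormula

open PowerSeries Finset

/-! ### Reciprocals of `q`-factorials -/

theorem qFactorial_zero : qFactorial 0 = 1 := by
  simp [qFactorial]

theorem qFactorial_succ (n : ℕ) : qFactorial (n + 1) = qFactorial n * (1 - X ^ (n + 1)) := by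
  simp [qFactorial, prod_range_succ]

theorem recip_eq_of_mul_eq_one {f g : ℤ⟦X⟧} (h : f * g = 1) (hf : constantCoeff f = 1) :
    recip f = g := by
  have h' := mul_recip hf
  calc recip f = (f * g) * recip f := by rw [h, one_mul]
    _ = (f * recip f) * g := by ring
    _ = g := by rw [h', one_mul]

theorem recip_mul {f g : ℤ⟦X⟧} (hf : constantCoeff f = 1) (hg : constantCoeff g = 1) :
    recip (f * g) = recip f * recip g := by
  refine recip_eq_of_mul_eq_one ?_ (by simp [hf, hg])
  calc f * g * (recip f * recip g) = (f * recip f) * (g * recip g) := by ring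
    _ = 1 := by rw [mul_recip hf, mul_recip hg, one_mul]

/-- The reciprocal `1 / (q)_n`. -/
noncomputable def recipQFactorial (n : ℕ) : ℤ⟦X⟧ :=
  recip (qFactorial n)

theorem recipQFactorial_zero : recipQFactorial 0 = 1 :=
  recip_eq_of_mul_eq_one (by simp [qFactorial_zero]) (constantCoeff_qFactorial 0)

theorem recipQFactorial_eq_mul_succ (n : ℕ) :
    recipQFactorial n = (1 - X ^ (n + 1)) * recipQFactorial (n + 1) := by
  refine recip_eq_of_mul_eq_one ?_ (constantCoeff_qFactorial n)
  rw [← mul_assoc, ← qFactorial_succ]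
  exact mul_recip (constantCoeff_qFactorial _)

theorem one_sub_X_pow_succ_ne_zero (n : ℕ) : (1 - X ^ (n + 1) : ℤ⟦X⟧) ≠ 0 := by
  intro h
  simpa using congrArg constantCoeff h

/-! ### The `q`-Vandermonde sum -/

/-- A limiting case of the `q`-Vandermonde sum. Splitting
`1 - q^(i+j) = q^j (1 - q^i) + (1 - q^j)` turns `1 - q^(N+1)` times the sum for `(N + 1, a)` into
the sum for `(N, a + 1)`. -/
theorem sum_antidiagonal_recipQFactorial (N a : ℕ) :
    ∑ x ∈ antidiagonal N, X ^ (x.2 * (x.2 + a)) *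
        (recipQFactorial x.1 * recipQFactorial x.2 * recipQFactorial (x.2 + a)) =
      recipQFactorial N * recipQFactorial (N + a) := by
  induction N generalizing a with
  | zero => simp [recipQFactorial_zero]
  | succ N ih =>
    apply mul_left_cancel₀ (one_sub_X_pow_succ_ne_zero N)
    have split : ∀ x ∈ antidiagonal (N + 1), (1 - X ^ (N + 1)) * (X ^ (x.2 * (x.2 + a)) *
        (recipQFactorial x.1 * recipQFactorial x.2 * recipQFactorial (x.2 + a))) =
        X ^ x.2 * (1 - X ^ x.1) * (X ^ (x.2 * (x.2 + a)) *
        (recipQFactorial x.1 * recipQFactorial x.2 * recipQFactorial (x.2 + a))) +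
        (1 - X ^ x.2) * (X ^ (x.2 * (x.2 + a)) *
        (recipQFactorial x.1 * recipQFactorial x.2 * recipQFactorial (x.2 + a))) := by
      intro x hx
      rw [← mem_antidiagonal.1 hx]
      ring
    rw [mul_sum, sum_congr rfl split, sum_add_distrib, Nat.sum_antidiagonal_succ,
      Nat.sum_antidiagonal_succ']
    simp only [pow_zero, sub_self, mul_zero, zero_mul, zero_add]
    rw [← sum_add_distrib, ← mul_assoc, ← recipQFactorial_eq_mul_succ,
      show N + 1 + a = N + (a + 1) by ring, ← ih (a + 1)]
    refine sum_congr rfl fun x _ => ?_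
    rw [show x.2 + 1 + a = x.2 + a + 1 by ring, show x.2 + (a + 1) = x.2 + a + 1 by ring,
      recipQFactorial_eq_mul_succ x.1, recipQFactorial_eq_mul_succ x.2,
      recipQFactorial_eq_mul_succ (x.2 + a)]
    ring

/-! ### The Bailey chain -/

/-- The sequence `α` of the unit Bailey pair relative to `a = 1`: `α_0 = 1` and
`α_s = (-1)^s q^{s(s-1)/2} (1 + q^s)` for `s ≥ 1`. -/
noncomputable def unitAlpha (s : ℕ) : ℤ⟦X⟧ :=
  if s = 0 then 1 else (-1) ^ s * X ^ s.choose 2 * (1 + X ^ s)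

/-- The partial sums of the unit Bailey pair telescope. -/
theorem sum_range_unitAlpha (m t : ℕ) :
    (1 - X ^ (m + t + 1)) * ∑ s ∈ range (m + 1), unitAlpha s *
        (recipQFactorial (m + t + 1 - s) * recipQFactorial (m + t + 1 + s)) =
      (-1) ^ m * X ^ (m + 1).choose 2 *
        (recipQFactorial t * recipQFactorial (m + t + 1 + m)) := by
  induction m generalizing t with
  | zero =>
    simp only [zero_add, sum_range_one, unitAlpha, if_true, Nat.sub_zero, add_zero]
    rw [recipQFactorial_eq_mul_succ t]
    simp
    ring
  | succ m ih =>
    have h := ih (t + 1)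
    rw [show m + (t + 1) + 1 = m + 1 + t + 1 by ring] at h
    rw [sum_range_succ, mul_add, h, show m + 1 + t + 1 - (m + 1) = t + 1 by omega,
      show m + 1 + t + 1 + (m + 1) = m + 1 + t + 1 + m + 1 by ring, recipQFactorial_eq_mul_succ t,
      recipQFactorial_eq_mul_succ (m + 1 + t + 1 + m), unitAlpha, if_neg (Nat.succ_ne_zero m),
      Nat.choose_succ_succ' (m + 1) 1, Nat.choose_one_right]
    ring

theorem sum_unitAlpha (n : ℕ) :
    ∑ s ∈ range (n + 1), unitAlpha s * (recipQFactorial (n - s) * recipQFactorial (n + s)) =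
      if n = 0 then 1 else 0 := by
  rcases n with _ | n
  · simp [unitAlpha, recipQFactorial_zero]
  apply mul_left_cancel₀ (one_sub_X_pow_succ_ne_zero n)
  rw [sum_range_succ, mul_add]
  have h := sum_range_unitAlpha n 0
  simp only [add_zero] at h
  rw [h, unitAlpha, if_neg n.succ_ne_zero, if_neg n.succ_ne_zero,
    show n + 1 + (n + 1) = n + 1 + n + 1 by ring, Nat.sub_self,
    recipQFactorial_eq_mul_succ (n + 1 + n)]
  ring

/-- Bailey's lemma relative to `a = 1`, with both parameters sent to infinity. -/
theorem bailey_step (α : ℕ → ℤ⟦X⟧) (n : ℕ) :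
    ∑ m ∈ range (n + 1), X ^ (m ^ 2) * recipQFactorial (n - m) *
        ∑ s ∈ range (m + 1), α s * (recipQFactorial (m - s) * recipQFactorial (m + s)) =
      ∑ s ∈ range (n + 1), X ^ (s ^ 2) * α s *
        (recipQFactorial (n - s) * recipQFactorial (n + s)) := by
  simp only [mul_sum]
  rw [sum_comm' (t' := range (n + 1)) (s' := fun s => Ico s (n + 1))
    (fun m s => by simp only [mem_range, mem_Ico]; omega)]
  refine sum_congr rfl fun s hs => ?_
  obtain ⟨N, rfl⟩ := Nat.exists_eq_add_of_le (Nat.lt_succ_iff.1 (mem_range.1 hs))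
  rw [sum_Ico_eq_sum_range, show s + N + 1 - s = N + 1 by omega, Nat.add_sub_cancel_left,
    show s + N + s = N + 2 * s by ring, ← sum_antidiagonal_recipQFactorial,
    Nat.sum_antidiagonal_eq_sum_range_succ_mk, ← sum_range_reflect, mul_sum]
  refine sum_congr rfl fun j hj => ?_
  have hj' : j ≤ N := Nat.lt_succ_iff.1 (mem_range.1 hj)
  obtain ⟨i, rfl⟩ := Nat.exists_eq_add_of_le hj'
  dsimp only
  rw [show s + (j + i) - (s + (j + i + 1 - 1 - j)) = j by omega,
    show s + (j + i + 1 - 1 - j) - s = i by omega, show j + i + 1 - 1 - j = i by omega,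
    Nat.add_sub_cancel_left, show s + i + s = i + 2 * s by ring]
  ring

/-! ### Gordon's multiple sum as an iterated Bailey sum -/

theorem Parts.part_of_lt {m : ℕ} (l : Parts m) {i : ℕ} (h : i < m) : l.part i = l.1 ⟨i, h⟩ :=
  dif_pos h

theorem Parts.part_of_le {m : ℕ} (l : Parts m) {i : ℕ} (h : m ≤ i) : l.part i = 0 :=
  dif_neg (not_lt.2 h)

theorem Parts.apply_le_part_zero {m : ℕ} (l : Parts m) (i : Fin m) : l.1 i ≤ l.part 0 := by
  rw [l.part_of_lt i.pos]
  exact l.2 (Fin.mk_le_of_le_val (Nat.zero_le _))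

/-- The empty partition. -/
def Parts.nil : Parts 0 :=
  ⟨Fin.elim0, Subsingleton.antitone _⟩

/-- The partition `(r, λ_1, …, λ_m)`, where `r ≥ λ_1`. -/
def Parts.cons {m : ℕ} (r : ℕ) (l : Parts m) (h : l.part 0 ≤ r) : Parts (m + 1) :=
  ⟨Fin.cons r l.1, by
    intro i j hij
    induction j using Fin.cases with
    | zero => rw [Fin.le_zero_iff.1 hij]
    | succ j =>
      induction i using Fin.cases with
      | zero => simpa using (l.apply_le_part_zero j).trans h
      | succ i => simpa using l.2 (Fin.succ_le_succ_iff.1 hij)⟩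

/-- The partition `(λ_2, …, λ_{m+1})`. -/
def Parts.tail {m : ℕ} (l : Parts (m + 1)) : Parts m :=
  ⟨Fin.tail l.1, fun _ _ hij => l.2 (Fin.succ_le_succ_iff.2 hij)⟩

theorem Parts.part_cons_zero {m : ℕ} (r : ℕ) (l : Parts m) (h : l.part 0 ≤ r) :
    (l.cons r h).part 0 = r := by
  rw [Parts.part_of_lt _ m.succ_pos]
  rfl

theorem Parts.part_cons_succ {m : ℕ} (r : ℕ) (l : Parts m) (h : l.part 0 ≤ r) (i : ℕ) :
    (l.cons r h).part (i + 1) = l.part i := by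
  by_cases hi : i < m
  · rw [Parts.part_of_lt _ hi, Parts.part_of_lt _ (Nat.succ_lt_succ hi)]
    rfl
  · rw [Parts.part_of_le _ (not_lt.1 hi), Parts.part_of_le _ (Nat.succ_le_succ (not_lt.1 hi))]

theorem Parts.part_tail {m : ℕ} (l : Parts (m + 1)) (i : ℕ) : l.tail.part i = l.part (i + 1) := by
  by_cases hi : i < m
  · rw [Parts.part_of_lt _ hi, Parts.part_of_lt _ (Nat.succ_lt_succ hi)]
    rfl
  · rw [Parts.part_of_le _ (not_lt.1 hi), Parts.part_of_le _ (Nat.succ_le_succ (not_lt.1 hi))]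

theorem Parts.part_zero_tail_le {m : ℕ} (l : Parts (m + 1)) : l.tail.part 0 ≤ l.part 0 := by
  rw [Parts.part_tail]
  by_cases hi : 0 + 1 < m + 1
  · rw [Parts.part_of_lt _ hi]
    exact l.apply_le_part_zero _
  · rw [Parts.part_of_le _ (not_lt.1 hi)]
    exact Nat.zero_le _

theorem Parts.cons_tail {m : ℕ} (l : Parts (m + 1)) :
    l.tail.cons (l.part 0) l.part_zero_tail_le = l :=
  Subtype.ext <| by
    simp only [Parts.cons, Parts.tail, Parts.part_of_lt l m.succ_pos]
    exact Fin.cons_self_tail l.1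

theorem Parts.tail_cons {m : ℕ} (r : ℕ) (l : Parts m) (h : l.part 0 ≤ r) : (l.cons r h).tail = l :=
  Subtype.ext <| Fin.tail_cons (α := fun _ => ℕ) r l.1

theorem gordonTerm_cons {m : ℕ} (r : ℕ) (l : Parts m) (h : l.part 0 ≤ r) :
    gordonTerm (l.cons r h) = X ^ (r ^ 2) * (gordonTerm l * recipQFactorial (r - l.part 0)) := by
  simp only [gordonTerm, recipQFactorial]
  rw [sum_range_succ', prod_range_succ', recip_mul (constantCoeff_prod_qFactorial _ _)
    (constantCoeff_qFactorial _)]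
  simp only [Parts.part_cons_succ, Parts.part_cons_zero, zero_add]
  ring

/-- The finite set of partitions with `m` parts, all of which are at most `n`. -/
def boundedParts (m n : ℕ) : Finset (Parts m) :=
  Finset.subtype Antitone (Fintype.piFinset fun _ : Fin m => range (n + 1))

theorem mem_boundedParts {m n : ℕ} {l : Parts m} : l ∈ boundedParts m n ↔ l.part 0 ≤ n := by
  unfold boundedParts
  refine mem_subtype.trans ?_
  rw [Fintype.mem_piFinset]
  simp only [mem_range, Nat.lt_succ_iff]
  refine ⟨fun h => ?_, fun h i => (l.apply_le_part_zero i).trans h⟩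
  by_cases hm : 0 < m
  · rw [Parts.part_of_lt _ hm]
    exact h _
  · rw [Parts.part_of_le _ (not_lt.1 hm)]
    exact Nat.zero_le _

/-- The finite form `∑_{λ_1 ≤ n} q^{λ_1² + ⋯ + λ_m²} / ((q)_{n - λ_1} (q)_{λ_1 - λ_2} ⋯ (q)_{λ_m})`
of Gordon's multiple sum. -/
noncomputable def gordonSum (m n : ℕ) : ℤ⟦X⟧ :=
  ∑ l ∈ boundedParts m n, gordonTerm l * recipQFactorial (n - l.part 0)

theorem gordonSum_zero (n : ℕ) : gordonSum 0 n = recipQFactorial n := by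
  have h : boundedParts 0 n = {Parts.nil} :=
    eq_singleton_iff_unique_mem.2
      ⟨mem_boundedParts.2 (by rw [Parts.part_of_le _ le_rfl]; exact Nat.zero_le _),
        fun l _ => Subtype.ext (funext fun i => i.elim0)⟩
  rw [gordonSum, h, sum_singleton, Parts.part_of_le _ le_rfl, gordonTerm]
  simp [recip_eq_of_mul_eq_one (one_mul 1) (map_one _)]

theorem gordonSum_succ (m n : ℕ) :
    gordonSum (m + 1) n =
      ∑ r ∈ range (n + 1), X ^ (r ^ 2) * recipQFactorial (n - r) * gordonSum m r := by
  simp only [gordonSum, mul_sum]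
  rw [sum_sigma']
  refine sum_bij' (fun l _ => ⟨l.part 0, l.tail⟩)
    (fun x hx => x.2.cons x.1 (mem_boundedParts.1 (mem_sigma.1 hx).2)) ?_ ?_ ?_ ?_ ?_
  · intro l hl
    exact mem_sigma.2 ⟨mem_range.2 (Nat.lt_succ_iff.2 (mem_boundedParts.1 hl)),
      mem_boundedParts.2 l.part_zero_tail_le⟩
  · intro x hx
    rw [mem_boundedParts, Parts.part_cons_zero]
    exact Nat.lt_succ_iff.1 (mem_range.1 (mem_sigma.1 hx).1)
  · intro l _
    exact l.cons_tail
  · intro x hx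
    simp only [Parts.part_cons_zero, Parts.tail_cons]
  · intro l _
    have h := gordonTerm_cons (l.part 0) l.tail l.part_zero_tail_le
    rw [Parts.cons_tail] at h
    simp only [h]
    ring

/-- Gordon's multiple sum is the `β` side of the Bailey pair obtained by `m + 1` Bailey steps from
the unit pair, and `q^{(m+1)s²} α_s` is its `α` side. -/
theorem gordonSum_eq (m n : ℕ) :
    gordonSum m n = ∑ s ∈ range (n + 1), X ^ ((m + 1) * s ^ 2) * unitAlpha s *
      (recipQFactorial (n - s) * recipQFactorial (n + s)) := by
  induction m generalizing n with
  | zero =>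
    have h := bailey_step unitAlpha n
    simp only [sum_unitAlpha, mul_ite, mul_one, mul_zero] at h
    rw [sum_ite_eq' , if_pos (mem_range.2 n.succ_pos)] at h
    simpa [gordonSum_zero] using h
  | succ m ih =>
    rw [gordonSum_succ]
    simp only [ih]
    rw [bailey_step]
    refine sum_congr rfl fun s _ => ?_
    ring

/-! ### Passage to the limit modulo `q^(d+1)` -/

/-- The reduction of power series modulo `q^(d+1)`. -/
noncomputable def reduce (d : ℕ) : ℤ⟦X⟧ →+* ℤ⟦X⟧ ⧸ Ideal.span {(X : ℤ⟦X⟧) ^ (d + 1)} :=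
  Ideal.Quotient.mk _

theorem reduce_eq_reduce_iff {d : ℕ} {f g : ℤ⟦X⟧} :
    reduce d f = reduce d g ↔ ∀ j ≤ d, coeff j f = coeff j g := by
  rw [reduce, Ideal.Quotient.eq, Ideal.mem_span_singleton, X_pow_dvd_iff]
  simp only [Nat.lt_succ_iff, map_sub, sub_eq_zero]

theorem reduce_X_pow {d n : ℕ} (h : d < n) : reduce d (X ^ n) = 0 :=
  Ideal.Quotient.eq_zero_iff_mem.2 (Ideal.mem_span_singleton.2 (pow_dvd_pow _ h))

theorem reduce_qFactorial {d n : ℕ} (h : d ≤ n) :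
    reduce d (qFactorial n) = reduce d qFactorialInf := by
  have stable : ∀ k ≥ d, reduce d (qFactorial k) = reduce d (qFactorial d) := by
    intro k hk
    induction k, hk using Nat.le_induction with
    | base => rfl
    | succ k hk ih =>
      rw [qFactorial_succ, map_mul, map_sub, map_one, reduce_X_pow (Nat.lt_succ_of_le hk),
        sub_zero, mul_one, ih]
  rw [stable n h, reduce_eq_reduce_iff]
  intro j hj
  have lim : Filter.Tendsto (fun n => coeff j (qFactorial n)) Filter.atTop
      (nhds (coeff j qFactorialInf)) :=
    ((WithPiTopology.continuous_coeff ℤ j).tendsto _).comp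
      (WithPiTopology.multipliable_one_sub_X_pow ℤ).hasProd.tendsto_prod_nat
  refine tendsto_nhds_unique (tendsto_const_nhds.congr' ?_) lim
  filter_upwards [Filter.eventually_ge_atTop d] with k hk
  exact (reduce_eq_reduce_iff.1 (stable k hk) j hj).symm

theorem reduce_recipQFactorial {d n : ℕ} (h : d ≤ n) :
    reduce d (recipQFactorial n) = reduce d (recip qFactorialInf) := by
  have h1 := congrArg (reduce d) (mul_recip (constantCoeff_qFactorial n))
  have h2 := congrArg (reduce d) (mul_recip constantCoeff_qFactorialInf)
  rw [map_mul, reduce_qFactorial h] at h1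
  rw [map_mul] at h2
  rw [recipQFactorial]
  rw [map_one] at h1 h2
  linear_combination (reduce d (recip qFactorialInf)) * h1 - (reduce d (recip (qFactorial n))) * h2

theorem reduce_gordonTerm {d m : ℕ} {l : Parts m} (h : d < l.part 0) :
    reduce d (gordonTerm l) = 0 := by
  have hm : 0 < m := by
    by_contra hm
    rw [l.part_of_le (not_lt.1 hm)] at h
    exact Nat.not_lt_zero _ h
  have hle : l.part 0 ≤ ∑ i ∈ range m, l.part i ^ 2 :=
    (Nat.le_self_pow two_ne_zero _).trans
      (single_le_sum (f := fun i => l.part i ^ 2) (fun _ _ => Nat.zero_le _) (mem_range.2 hm))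
  rw [gordonTerm, map_mul, reduce_X_pow (h.trans_le hle), zero_mul]

theorem reduce_sum_gordonTerm (d m : ℕ) {n : ℕ} (hn : 2 * d ≤ n) :
    reduce d (∑ l ∈ boundedParts m n, gordonTerm l) =
      reduce d (recip qFactorialInf *
        ∑ s ∈ range (n + 1), X ^ ((m + 1) * s ^ 2) * unitAlpha s) := by
  have key := congrArg (reduce d) (gordonSum_eq m n)
  -- Modulo `q^(d+1)`, every `1 / (q)_k` that meets a nonzero term has `k ≥ d`.
  have left : reduce d (gordonSum m n) =
      reduce d (∑ l ∈ boundedParts m n, gordonTerm l) * reduce d (recip qFactorialInf) := by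
    rw [gordonSum, map_sum, map_sum, sum_mul]
    refine sum_congr rfl fun l _ => ?_
    rw [map_mul]
    by_cases h : d < l.part 0
    · rw [reduce_gordonTerm h, zero_mul, zero_mul]
    · rw [reduce_recipQFactorial (by omega)]
  have right : reduce d (∑ s ∈ range (n + 1), X ^ ((m + 1) * s ^ 2) * unitAlpha s *
      (recipQFactorial (n - s) * recipQFactorial (n + s))) =
      reduce d (recip qFactorialInf *
        ∑ s ∈ range (n + 1), X ^ ((m + 1) * s ^ 2) * unitAlpha s) *
          reduce d (recip qFactorialInf) := by
    rw [map_mul, map_sum, map_sum, mul_sum, sum_mul]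
    refine sum_congr rfl fun s _ => ?_
    rw [map_mul, map_mul, map_mul]
    by_cases h : d < s
    · rw [reduce_X_pow (by nlinarith)]
      ring
    · rw [reduce_recipQFactorial (by omega), reduce_recipQFactorial (by omega)]
      ring
  rw [left, right] at key
  have unit := congrArg (reduce d) (mul_recip constantCoeff_qFactorialInf)
  rw [map_mul, map_one] at unit
  linear_combination (reduce d qFactorialInf) * key -
    (reduce d (∑ l ∈ boundedParts m n, gordonTerm l) - reduce d (recip qFactorialInf *
        ∑ s ∈ range (n + 1), X ^ ((m + 1) * s ^ 2) * unitAlpha s)) * unit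

/-! ### The Rocha-Caridi sum -/

theorem rochaCaridiTerm_natCast (k l : ℕ) :
    rochaCaridiTerm 2 (2 * k + 1) 1 k l =
      X ^ (k * (2 * l) ^ 2 + l * (2 * l + 1)) - X ^ (k * (2 * l + 1) ^ 2 + (2 * l + 1) * l) := by
  have h1 : expPos 2 (2 * k + 1) 1 k l = (k * (2 * l) ^ 2 + l * (2 * l + 1) : ℕ) := by
    simp only [expPos]
    push_cast
    ring
  have h2 : expNeg 2 (2 * k + 1) 1 k l = (k * (2 * l + 1) ^ 2 + (2 * l + 1) * l : ℕ) := by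
    simp only [expNeg]
    push_cast
    ring
  rw [rochaCaridiTerm, h1, h2, Int.toNat_natCast, Int.toNat_natCast]

theorem rochaCaridiTerm_neg_add_one (k l : ℕ) :
    rochaCaridiTerm 2 (2 * k + 1) 1 k (-(l + 1 : ℤ)) =
      X ^ (k * (2 * l + 2) ^ 2 + (l + 1) * (2 * l + 1)) -
        X ^ (k * (2 * l + 1) ^ 2 + (2 * l + 1) * (l + 1)) := by
  have h1 : expPos 2 (2 * k + 1) 1 k (-(l + 1 : ℤ)) =
      (k * (2 * l + 2) ^ 2 + (l + 1) * (2 * l + 1) : ℕ) := by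
    simp only [expPos]
    push_cast
    ring
  have h2 : expNeg 2 (2 * k + 1) 1 k (-(l + 1 : ℤ)) =
      (k * (2 * l + 1) ^ 2 + (2 * l + 1) * (l + 1) : ℕ) := by
    simp only [expNeg]
    push_cast
    ring
  rw [rochaCaridiTerm, h1, h2, Int.toNat_natCast, Int.toNat_natCast]

theorem unitAlpha_two_mul_add_one (l : ℕ) :
    unitAlpha (2 * l + 1) = -(X ^ ((2 * l + 1) * l) * (1 + X ^ (2 * l + 1))) := by
  have h : (2 * l + 1).choose 2 = (2 * l + 1) * l := by
    rw [Nat.choose_two_right, Nat.add_sub_cancel]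
    exact Nat.div_eq_of_eq_mul_left two_pos (by ring)
  rw [unitAlpha, if_neg (by omega), h, Odd.neg_one_pow (odd_two_mul_add_one l)]
  ring

theorem unitAlpha_two_mul_add_two (l : ℕ) :
    unitAlpha (2 * l + 2) = X ^ ((l + 1) * (2 * l + 1)) * (1 + X ^ (2 * l + 2)) := by
  have h : (2 * l + 2).choose 2 = (l + 1) * (2 * l + 1) := by
    rw [Nat.choose_two_right]
    exact Nat.div_eq_of_eq_mul_left two_pos (by rw [Nat.add_succ_sub_one]; ring)
  rw [unitAlpha, if_neg (by omega), h, Even.neg_one_pow ⟨l + 1, by ring⟩]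
  ring

/-- Folding the bilateral sum. Each `α_s` with `s ≥ 1` consists of two monomials: for odd `s` they
are the negative terms of the Rocha-Caridi sum, for even `s` the positive ones, and `α_0` is the
positive term of index `0`. On the left only the first monomial of `α_{2N+2}` is present. -/
theorem sum_range_rochaCaridiTerm (k N : ℕ) :
    ∑ l ∈ range (N + 1), (rochaCaridiTerm 2 (2 * k + 1) 1 k l +
        rochaCaridiTerm 2 (2 * k + 1) 1 k (-(l + 1 : ℤ))) =
      ∑ s ∈ range (2 * N + 2), X ^ (k * s ^ 2) * unitAlpha s +
        X ^ (k * (2 * N + 2) ^ 2 + (N + 1) * (2 * N + 1)) := by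
  simp only [rochaCaridiTerm_natCast, rochaCaridiTerm_neg_add_one]
  induction N with
  | zero =>
    simp [sum_range_succ, unitAlpha]
    ring
  | succ N ih =>
    rw [sum_range_succ, ih, show 2 * (N + 1) + 2 = 2 * N + 2 + 1 + 1 by ring,
      sum_range_succ _ (2 * N + 2 + 1), sum_range_succ _ (2 * N + 2),
      show 2 * N + 2 + 1 = 2 * (N + 1) + 1 by ring,
      unitAlpha_two_mul_add_one, unitAlpha_two_mul_add_two]
    ring

theorem reduce_tsum_rochaCaridiTerm (d : ℕ) {k : ℕ} (hk : 0 < k) :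
    reduce d (∑' l, rochaCaridiTerm 2 (2 * k + 1) 1 k l) =
      reduce d (∑ s ∈ range (2 * d + 2), X ^ (k * s ^ 2) * unitAlpha s) := by
  have hs := (summable_rochaCaridiTerm (p := 2) (p' := 2 * k + 1) (r := 1) (s := k) one_pos
    one_lt_two hk (by omega)).hasSum.nat_add_neg_add_one
  have vanish : ∀ l : ℤ, (d : ℤ) < |l| → reduce d (rochaCaridiTerm 2 (2 * k + 1) 1 k l) = 0 := by
    intro l hl
    have h1 := expPos_ge (p := 2) (p' := 2 * k + 1) one_pos one_lt_two hk (by omega) l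
    have h2 := expNeg_ge (p := 2) (p' := 2 * k + 1) one_pos one_lt_two hk (by omega) l
    rw [rochaCaridiTerm, map_sub, reduce_X_pow (by omega), reduce_X_pow (by omega), sub_zero]
  have trunc : reduce d (∑' l, rochaCaridiTerm 2 (2 * k + 1) 1 k l) =
      reduce d (∑ l ∈ range (d + 1), (rochaCaridiTerm 2 (2 * k + 1) 1 k l +
        rochaCaridiTerm 2 (2 * k + 1) 1 k (-(l + 1 : ℤ)))) := by
    rw [reduce_eq_reduce_iff]
    intro j hj
    refine ((WithPiTopology.hasSum_iff_hasSum_coeff ℤ).1 hs j).unique ?_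
    rw [map_sum]
    refine hasSum_sum_of_ne_finset_zero fun l hl => ?_
    have hl' : d < l := by simpa using hl
    have hz : reduce d (rochaCaridiTerm 2 (2 * k + 1) 1 k l +
        rochaCaridiTerm 2 (2 * k + 1) 1 k (-(l + 1 : ℤ))) = reduce d 0 := by
      rw [map_add, vanish _ (lt_abs.2 (Or.inl (by omega))),
        vanish _ (lt_abs.2 (Or.inr (by omega))), map_zero, add_zero]
    simpa using reduce_eq_reduce_iff.1 hz j hj
  rw [trunc, sum_range_rochaCaridiTerm, map_add, reduce_X_pow, add_zero]
  nlinarith [Nat.zero_le (k * (2 * d + 2) ^ 2)]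

end GordonFormula

theorem mainTheorem4 (e₀ : ℕ) (he₀ : 1 ≤ e₀) :
    HasSum (fun l : GordonFormula.Parts (e₀ - 1) => GordonFormula.gordonTerm l)
      (GordonFormula.virasoroChar 2 (2 * e₀ + 1) 1 e₀) := by
  open GordonFormula PowerSeries in
  obtain ⟨m, rfl⟩ := Nat.exists_eq_add_of_le' he₀
  rw [Nat.add_sub_cancel, WithPiTopology.hasSum_iff_hasSum_coeff]
  intro d
  have h : reduce d (virasoroChar 2 (2 * (m + 1) + 1) 1 (m + 1)) =
      reduce d (∑ l ∈ boundedParts m (2 * d + 1), gordonTerm l) := by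
    rw [reduce_sum_gordonTerm d m (Nat.le_succ _), virasoroChar, map_mul, map_mul,
      reduce_tsum_rochaCaridiTerm d m.succ_pos]
  rw [reduce_eq_reduce_iff.1 h d le_rfl, map_sum]
  refine hasSum_sum_of_ne_finset_zero fun l hl => ?_
  have hl' : d < l.part 0 := by
    rw [mem_boundedParts] at hl
    omega
  have hz : reduce d (gordonTerm l) = reduce d 0 := by rw [reduce_gordonTerm hl', map_zero]
  simpa using reduce_eq_reduce_iff.1 hz d le_rfl
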